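/- Let $\mathbf D$ be the Dirichlet class of all real functions $f\in L^2(\mathbb R^3)$ whose distributional first partial derivatives belong to $L^2(\mathbb R^3)$. For a bounded set $F\subset\mathbb R^3$ let $k(F)>0$ be the greatest positive number $k$ such that $$k^2\int_F|f|^2\,dv\le\frac1{4\pi}\int_{\mathbb R^3}\|\nabla f\|^2\,dv\qquad\text{for every } f\in\mathbf D,$$ and let $$C(F)=\frac1{4\pi}\int_{\mathbb R^3\setminus F}\|\nabla U\|^2\,dv$$ be the capacity of $F$, where $U$ is the capacitary potential of $F$: a locally integrable real function on $\mathbb R^3$ whose distributional gradient belongs to $L^2(\mathbb R^3)$, with $U=1$ on $F$, $U$ harmonic outside $\overline F$, and $U(x)\to0$ as $\|x\|\to\infty$. Let $r>0$ and let $F$ be the (open or closed) ball of radius $r$ about the origin of $\mathbb R^3$. Then $k(F)$ and such a potential $U$ exist, and $$\frac{3}{4r\sqrt{2\pi}}\le k(F)\le\sqrt{\frac{C(F)}{|F|}},$$ where $|F|$ is the volume of $F$ (and the upper bound holds for every such $U$). -/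

import Mathlib

open MeasureTheory Filter Topology
open scoped ContDiff

namespace Conductor

/-- The space `ℝ³` with the Euclidean norm. -/
abbrev E3 : Type := EuclideanSpace ℝ (Fin 3)

/-- `f` is a locally integrable function on `ℝ³` whose distributional partial derivatives are given
by the components of the square integrable vector field `G`, i.e. `∇f = G` and `G ∈ L²`. -/
structure HasL2WeakGradient (f : E3 → ℝ) (G : E3 → E3) : Prop where
  locallyIntegrable : LocallyIntegrable f volume
  memLp_gradient : MemLp G 2 volume
  integral_eq : ∀ φ : E3 → ℝ, ContDiff ℝ ∞ φ → HasCompactSupport φ → ∀ i : Fin 3,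
    ∫ x, f x * fderiv ℝ φ x (EuclideanSpace.single i 1) = - ∫ x, G x i * φ x

/-- `f` belongs to the Dirichlet class `𝐃` (`f` and its distributional first derivatives
are in `L²(ℝ³)`), with `∇f = G`. -/
structure MemDirichlet (f : E3 → ℝ) (G : E3 → E3) : Prop extends HasL2WeakGradient f G where
  memLp : MemLp f 2 volume

/-- `k = k(F)`: the greatest positive number such that
`k² ∫_F |f|² ≤ (1 / 4π) ∫_{ℝ³} ‖∇f‖²` for every `f` in the Dirichlet class. -/
def IsBestConstant (F : Set E3) (k : ℝ) : Prop :=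
  IsGreatest {k : ℝ | 0 < k ∧ ∀ (f : E3 → ℝ) (G : E3 → E3), MemDirichlet f G →
    k ^ 2 * ∫ x in F, f x ^ 2 ≤ 1 / (4 * Real.pi) * ∫ x, ‖G x‖ ^ 2} k

/-- `U`, with distributional gradient `G ∈ L²(ℝ³)`, is the capacitary potential of `F`:
it equals `1` on `F`, is harmonic outside (the closure of) `F` and tends to zero at infinity.
Square integrability of `U` itself is not required: already for a ball, `U x = r / ‖x‖` outside the
ball is not in `L²(ℝ³)`. -/
structure IsCapacitaryPotential (F : Set E3) (U : E3 → ℝ) (G : E3 → E3) : Prop extends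
    HasL2WeakGradient U G where
  eq_one : ∀ x ∈ F, U x = 1
  harmonic : InnerProductSpace.HarmonicOnNhd U (closure F)ᶜ
  tendsto_zero : Tendsto U (cocompact E3) (𝓝 0)

/-- `c = C(F)`: the capacity `(1 / 4π) ∫_{ℝ³ \ F} ‖∇U‖²`, with `U` the capacitary potential. -/
def IsCapacity (F : Set E3) (c : ℝ) : Prop :=
  ∃ (U : E3 → ℝ) (G : E3 → E3), IsCapacitaryPotential F U G ∧
    c = 1 / (4 * Real.pi) * ∫ x in Fᶜ, ‖G x‖ ^ 2

end Conductor

namespace Conductor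

/-! Both bounds come from explicit radial objects, and the capacity enters only through the number
`r`.

Upper bound: the conductor potential `r / max r ‖x‖` has energy `4πr` but is not in `L²`. Lowered by
`ε` and cut at zero, it has compact support, equals `1 - ε` on `F` and has energy at most `4πr`;
letting `ε → 0` gives `k² |F| ≤ r` (`Admissible.sq_mul_le`). Conversely `r ≤ C(F)` for every
potential `U` (`HasL2WeakGradient.le_integral_compl`): testing `∇U` against a smooth cutoff of the
field `x / ‖x‖³` shows that its flux is nearly `4π`, and Young's inequality turns this into an
energy bound.

Lower bound: for a vector field `V`, expanding `‖∇f + f V‖² ≥ 0` and integrating by parts gives `∫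
‖∇f‖² ≥ ∫ f² (div V - ‖V‖²)`. An explicit rational radial `V` makes `div V - ‖V‖²` nonnegative
everywhere and at least `9 / (8 r²)` on the ball, which is `k ≥ 3 / (4 r √(2π))` after division by
`4π`. Mollification carries the inequality from smooth `f` to the whole Dirichlet class. -/

/-! ### Radial calculus on `ℝ³` -/

lemma innerSL_single (x : E3) (i : Fin 3) :
    innerSL ℝ x (EuclideanSpace.single i (1 : ℝ)) = x i := by
  simp [EuclideanSpace.inner_single_right]

lemma sum_sq_eq_norm_sq (x : E3) : ∑ i, x i ^ 2 = ‖x‖ ^ 2 := by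
  simp [EuclideanSpace.norm_sq_eq]

lemma abs_coord_le_norm (x : E3) (i : Fin 3) : |x i| ≤ ‖x‖ := by
  simpa using PiLp.norm_apply_le x i

lemma hasFDerivAt_norm {x : E3} (hx : x ≠ 0) :
    HasFDerivAt (fun y : E3 ↦ ‖y‖) (‖x‖⁻¹ • innerSL ℝ x) x := by
  have h := (hasStrictFDerivAt_norm_sq x).hasFDerivAt.sqrt (by positivity)
  simp only [Real.sqrt_sq (norm_nonneg _)] at h
  refine h.congr_fderiv ?_
  ext v
  simp
  field_simp

lemma hasFDerivAt_radial {u : ℝ → ℝ} {u' : ℝ} {x : E3} (hx : x ≠ 0) (hu : HasDerivAt u u' ‖x‖) :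
    HasFDerivAt (fun y : E3 ↦ u ‖y‖) ((u' / ‖x‖) • innerSL ℝ x) x := by
  refine (hu.comp_hasFDerivAt x (hasFDerivAt_norm hx)).congr_fderiv ?_
  rw [smul_smul, div_eq_mul_inv]

lemma integral_radial (f : ℝ → ℝ) :
    ∫ x : E3, f ‖x‖ = 4 * Real.pi * ∫ y in Set.Ioi (0 : ℝ), y ^ 2 * f y := by
  rw [integral_fun_norm_addHaar]
  have h : (ENNReal.ofReal (Real.pi * 4 / 3)).toReal = Real.pi * 4 / 3 :=
    ENNReal.toReal_ofReal (by positivity)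
  simp [Measure.real, EuclideanSpace.volume_ball_fin_three]
  rw [h]
  ring

lemma integrable_radial {f : ℝ → ℝ}
    (hf : IntegrableOn (fun y ↦ y ^ 2 * f y) (Set.Ioi (0 : ℝ))) :
    Integrable (fun x : E3 ↦ f ‖x‖) := by
  rw [integrable_fun_norm_addHaar]
  simpa using hf

lemma ae_norm_ne (c : ℝ) : ∀ᵐ x : E3, ‖x‖ ≠ c := by
  rw [ae_iff]
  have h := Measure.addHaar_sphere (volume : Measure E3) 0 c
  convert h using 2
  ext x
  simp

/-- Integration by parts needs only Lipschitz regularity, so the kinks of the truncated potentials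
are harmless. -/
lemma LipschitzWith.hasL2WeakGradient {f : E3 → ℝ} {G : E3 → E3} {C : NNReal}
    (hf : LipschitzWith C f) (hG : MemLp G 2 volume)
    (h : ∀ᵐ x, ∀ i, lineDeriv ℝ f x (EuclideanSpace.single i 1) = G x i) :
    HasL2WeakGradient f G where
  locallyIntegrable := hf.continuous.locallyIntegrable
  memLp_gradient := hG
  integral_eq φ hφ hc i := by
    obtain ⟨D, hD⟩ := hφ.lipschitzWith_of_hasCompactSupport hc (by simp)
    have key := hf.integral_lineDeriv_mul_eq (μ := volume) hD hc (EuclideanSpace.single i 1)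
    have h1 : ∫ x, lineDeriv ℝ f x (EuclideanSpace.single i 1) * φ x = ∫ x, G x i * φ x :=
      integral_congr_ae (h.mono fun x hx ↦ by simp only [hx i])
    rw [← h1, key, ← integral_neg]
    refine integral_congr_ae (.of_forall fun x ↦ ?_)
    have := ((hφ.differentiable (by simp)) x).lineDeriv_eq_fderiv
      (v := -EuclideanSpace.single i (1 : ℝ))
    simp only [this, map_neg]
    ring

/-! ### Truncated conductor potentials of the ball -/

/-- The square norm of the gradient of `r / ‖x‖`, restricted to the exterior of the ball. -/
noncomputable def exteriorEnergy (r ρ : ℝ) : ℝ := if r < ρ then r ^ 2 / ρ ^ 4 else 0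

lemma exteriorEnergy_nonneg (r ρ : ℝ) : 0 ≤ exteriorEnergy r ρ := by
  unfold exteriorEnergy; split_ifs <;> positivity

lemma sq_mul_exteriorEnergy {r : ℝ} (hr : 0 < r) :
    (fun y ↦ y ^ 2 * exteriorEnergy r y) =
      (Set.Ioi r).indicator fun y ↦ r ^ 2 * y ^ (-2 : ℝ) := by
  ext y
  by_cases h : r < y
  · have hy : 0 < y := hr.trans h
    rw [Set.indicator_of_mem (by exact h), exteriorEnergy, if_pos h, Real.rpow_neg hy.le]
    norm_cast
    field_simp
  · rw [Set.indicator_of_notMem (by exact h), exteriorEnergy, if_neg h, mul_zero]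

lemma integrable_exteriorEnergy {r : ℝ} (hr : 0 < r) :
    Integrable (fun x : E3 ↦ exteriorEnergy r ‖x‖) := by
  apply integrable_radial
  rw [sq_mul_exteriorEnergy hr]
  apply Integrable.integrableOn
  rw [integrable_indicator_iff measurableSet_Ioi]
  exact (integrableOn_Ioi_rpow_of_lt (by norm_num) hr).const_mul _

lemma integral_exteriorEnergy {r : ℝ} (hr : 0 < r) :
    ∫ x : E3, exteriorEnergy r ‖x‖ = 4 * Real.pi * r := by
  rw [integral_radial, sq_mul_exteriorEnergy hr, setIntegral_indicator measurableSet_Ioi,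
    Set.inter_eq_right.2 (Set.Ioi_subset_Ioi hr.le), integral_const_mul,
    integral_Ioi_rpow_of_lt (by norm_num) hr]
  norm_num [Real.rpow_neg_one]
  field_simp

/-- The profile of the conductor potential of the ball of radius `r`, lowered by `ε` and
truncated at zero. -/
noncomputable def profile (r ε ρ : ℝ) : ℝ := max (r / max r ρ - ε) 0

/-- The gradient of the radial function with profile `profile r ε`. -/
noncomputable def profileGradient (r ε : ℝ) (x : E3) : E3 :=
  if r < ‖x‖ ∧ ε * ‖x‖ < r then (-(r / ‖x‖ ^ 3)) • x else 0

lemma abs_profile_sub_le {r : ℝ} (hr : 0 < r) (ε p q : ℝ) :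
    |profile r ε p - profile r ε q| ≤ r⁻¹ * |p - q| := by
  unfold profile
  refine (abs_max_sub_max_le_abs _ _ _).trans ?_
  have hp : r ≤ max r p := le_max_left _ _
  have hq : r ≤ max r q := le_max_left _ _
  have hp0 := hr.trans_le hp
  have hq0 := hr.trans_le hq
  have h1 : |max r q - max r p| ≤ |p - q| := by
    rw [abs_sub_comm p q, max_comm r q, max_comm r p]
    exact abs_max_sub_max_le_abs _ _ _
  have h2 : r / max r p - ε - (r / max r q - ε)
      = r * (max r q - max r p) / (max r p * max r q) := by
    field_simp
    ring
  rw [h2, abs_div, abs_mul, abs_of_pos hr, abs_of_pos (mul_pos hp0 hq0), inv_mul_eq_div,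
    div_le_div_iff₀ (mul_pos hp0 hq0) hr]
  have h3 : r * r ≤ max r p * max r q := mul_le_mul hp hq hr.le hp0.le
  nlinarith [abs_nonneg (p - q), abs_nonneg (max r q - max r p),
    mul_le_mul h1 h3 (by positivity) (abs_nonneg _)]

lemma lipschitzWith_profile {r : ℝ} (hr : 0 < r) (ε : ℝ) :
    LipschitzWith (Real.toNNReal r⁻¹) fun x : E3 ↦ profile r ε ‖x‖ := by
  refine LipschitzWith.of_dist_le' fun x y ↦ ?_
  rw [Real.dist_eq, dist_eq_norm]
  refine (abs_profile_sub_le hr ε _ _).trans ?_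
  gcongr
  exact abs_norm_sub_norm_le x y

lemma norm_profileGradient_sq_le {r : ℝ} (hr : 0 < r) (ε : ℝ) (x : E3) :
    ‖profileGradient r ε x‖ ^ 2 ≤ exteriorEnergy r ‖x‖ := by
  unfold profileGradient
  split_ifs with h
  · have hx : 0 < ‖x‖ := hr.trans h.1
    rw [exteriorEnergy, if_pos h.1, norm_smul, norm_neg, Real.norm_eq_abs,
      abs_of_pos (by positivity)]
    apply le_of_eq
    field_simp
  · simpa using exteriorEnergy_nonneg r ‖x‖

lemma memLp_profileGradient {r : ℝ} (hr : 0 < r) (ε : ℝ) :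
    MemLp (profileGradient r ε) 2 volume := by
  have hm : Measurable (profileGradient r ε) := by
    unfold profileGradient
    refine Measurable.ite ?_ (by fun_prop) measurable_const
    exact (measurableSet_lt measurable_const measurable_norm).inter
      (measurableSet_lt (measurable_norm.const_mul ε) measurable_const)
  rw [memLp_two_iff_integrable_sq_norm hm.aestronglyMeasurable]
  refine (integrable_exteriorEnergy hr).mono' (hm.norm.pow_const 2).aestronglyMeasurable (.of_forall fun x ↦ ?_)
  rw [Real.norm_eq_abs, abs_of_nonneg (by positivity)]
  exact norm_profileGradient_sq_le hr ε x

lemma integral_norm_profileGradient_sq_le {r : ℝ} (hr : 0 < r) (ε : ℝ) :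
    ∫ x, ‖profileGradient r ε x‖ ^ 2 ≤ 4 * Real.pi * r := by
  rw [← integral_exteriorEnergy hr]
  exact integral_mono_of_nonneg (.of_forall fun x ↦ by positivity) (integrable_exteriorEnergy hr)
    (.of_forall fun x ↦ norm_profileGradient_sq_le hr ε x)

lemma hasDerivAt_profile {r ε ρ : ℝ} (hr : 0 < r) (hε : ε < 1) (h1 : ρ ≠ r) (h2 : ε * ρ ≠ r) :
    HasDerivAt (profile r ε) (if r < ρ ∧ ε * ρ < r then -(r / ρ ^ 2) else 0) ρ := by
  rcases lt_or_gt_of_ne h1 with h | h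
  · rw [if_neg (by intro H; linarith [H.1])]
    refine (hasDerivAt_const ρ (1 - ε)).congr_of_eventuallyEq ?_
    filter_upwards [Iio_mem_nhds h] with y hy
    rw [profile, max_eq_left (show y ≤ r from le_of_lt hy), div_self hr.ne', max_eq_left (by linarith)]
  · have hρ : 0 < ρ := hr.trans h
    have hc : ContinuousAt (fun y : ℝ ↦ ε * y) ρ := by fun_prop
    rcases lt_or_gt_of_ne h2 with h' | h'
    · rw [if_pos ⟨h, h'⟩]
      have hd : HasDerivAt (fun y : ℝ ↦ r * y⁻¹ - ε) (r * (-(ρ ^ 2)⁻¹)) ρ :=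
        ((hasDerivAt_inv hρ.ne').const_mul r).sub_const ε
      have hd' : HasDerivAt (fun y : ℝ ↦ r * y⁻¹ - ε) (-(r / ρ ^ 2)) ρ := by
        convert hd using 1
        ring
      refine hd'.congr_of_eventuallyEq ?_
      filter_upwards [Ioi_mem_nhds h, hc (Iio_mem_nhds h')] with y hy hy'
      have hy0 : 0 < y := hr.trans hy
      have : ε ≤ r / y := by rw [le_div_iff₀ hy0]; exact le_of_lt hy'
      rw [profile, max_eq_right (show r ≤ y from le_of_lt hy), max_eq_left (by linarith), div_eq_mul_inv]
    · rw [if_neg (by intro H; linarith [H.2])]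
      refine (hasDerivAt_const ρ (0 : ℝ)).congr_of_eventuallyEq ?_
      filter_upwards [Ioi_mem_nhds h, hc (Ioi_mem_nhds h')] with y hy hy'
      have hy0 : 0 < y := hr.trans hy
      have : r / y ≤ ε := by rw [div_le_iff₀ hy0]; exact le_of_lt hy'
      rw [profile, max_eq_right (show r ≤ y from le_of_lt hy), max_eq_right (by linarith)]

lemma hasL2WeakGradient_profile {r ε : ℝ} (hr : 0 < r) (hε : ε < 1) :
    HasL2WeakGradient (fun x ↦ profile r ε ‖x‖) (profileGradient r ε) := by
  refine LipschitzWith.hasL2WeakGradient (lipschitzWith_profile hr ε)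
    (memLp_profileGradient hr ε) ?_
  -- Off three null spheres: the origin and the two kinks. For `ε = 0` there is no outer kink, and
  -- `r / ε` is the default value `0`.
  filter_upwards [ae_norm_ne 0, ae_norm_ne r, ae_norm_ne (r / ε)] with x h0 h1 h2 i
  have hx : x ≠ 0 := norm_ne_zero_iff.1 h0
  have h2' : ε * ‖x‖ ≠ r := by
    intro H
    rcases eq_or_ne ε 0 with rfl | he
    · simp at H; exact hr.ne H
    · exact h2 (by rw [← H]; field_simp)
  rw [((hasFDerivAt_radial hx (hasDerivAt_profile hr hε h1 h2')).hasLineDerivAt _).lineDeriv]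
  unfold profileGradient
  rw [smul_apply, innerSL_single]
  split_ifs
  · simp only [PiLp.smul_apply, smul_eq_mul]
    field_simp
  · simp

/-- The reason for lowering by `ε`: the potential itself decays like `r / ‖x‖`, too slowly for `L²`.
-/
lemma hasCompactSupport_profile {r ε : ℝ} (hr : 0 < r) (hε : 0 < ε) :
    HasCompactSupport fun x : E3 ↦ profile r ε ‖x‖ := by
  refine HasCompactSupport.intro (isCompact_closedBall (0 : E3) (max r (r / ε))) fun x hx ↦ ?_
  simp only [Metric.mem_closedBall, dist_zero_right, max_lt_iff, not_le] at hx
  have h : r / ‖x‖ ≤ ε := by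
    have hx0 : 0 < ‖x‖ := hr.trans hx.1
    rw [div_le_iff₀ hx0, mul_comm]
    exact ((div_lt_iff₀ hε).1 hx.2).le
  rw [profile, max_eq_right hx.1.le, max_eq_right (by linarith)]

lemma memDirichlet_profile {r ε : ℝ} (hr : 0 < r) (hε : 0 < ε) (hε1 : ε < 1) :
    MemDirichlet (fun x ↦ profile r ε ‖x‖) (profileGradient r ε) where
  toHasL2WeakGradient := hasL2WeakGradient_profile hr hε1
  memLp := (lipschitzWith_profile hr ε).continuous.memLp_of_hasCompactSupport
    (hasCompactSupport_profile hr hε)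

/-! ### Harmonicity of `1 / ‖x‖` and existence of the capacitary potential -/

lemma hasFDerivAt_inv_norm {x : E3} (hx : x ≠ 0) :
    HasFDerivAt (fun y : E3 ↦ ‖y‖⁻¹) ((-(‖x‖ ^ 3)⁻¹) • innerSL ℝ x) x := by
  have hx' : ‖x‖ ≠ 0 := norm_ne_zero_iff.2 hx
  have h := hasFDerivAt_radial hx (hasDerivAt_inv hx')
  rwa [show -(‖x‖ ^ 2)⁻¹ / ‖x‖ = -(‖x‖ ^ 3)⁻¹ by field_simp] at h

lemma hasFDerivAt_inv_norm_pow_three {x : E3} (hx : x ≠ 0) :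
    HasFDerivAt (fun y : E3 ↦ -(‖y‖ ^ 3)⁻¹) ((3 * (‖x‖ ^ 5)⁻¹) • innerSL ℝ x) x := by
  have hx' : ‖x‖ ≠ 0 := norm_ne_zero_iff.2 hx
  have h : HasDerivAt (fun ρ : ℝ ↦ -(ρ ^ 3)⁻¹) (3 * (‖x‖ ^ 4)⁻¹) ‖x‖ := by
    have e : 3 * (‖x‖ ^ 4)⁻¹ = -(-(((3 : ℕ) : ℝ) * ‖x‖ ^ (3 - 1)) / (‖x‖ ^ 3) ^ 2) := by
      push_cast
      field_simp
    rw [e]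
    exact ((hasDerivAt_pow 3 ‖x‖).inv (pow_ne_zero 3 hx')).neg
  have h' := hasFDerivAt_radial hx h
  rwa [show 3 * (‖x‖ ^ 4)⁻¹ / ‖x‖ = 3 * (‖x‖ ^ 5)⁻¹ by field_simp] at h'

lemma laplacian_inv_norm {x : E3} (hx : x ≠ 0) :
    Laplacian.laplacian (fun y : E3 ↦ ‖y‖⁻¹) x = 0 := by
  have hx' : ‖x‖ ≠ 0 := norm_ne_zero_iff.2 hx
  -- `innerSL` is typed as conjugate-linear in its first argument; `B` is the same map as a plain
  -- bilinear one, to which the product rule applies.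
  obtain ⟨B, hB, hBv⟩ : ∃ B : E3 →L[ℝ] E3 →L[ℝ] ℝ,
      (∀ v, B v = innerSL ℝ v) ∧ ∀ v w, B v w = inner ℝ v w :=
    ⟨innerSL ℝ, fun _ ↦ rfl, fun _ _ ↦ rfl⟩
  have h1 : fderiv ℝ (fun y : E3 ↦ ‖y‖⁻¹) =ᶠ[𝓝 x] fun y ↦ (-(‖y‖ ^ 3)⁻¹) • B y := by
    filter_upwards [isOpen_ne.mem_nhds hx] with y hy
    rw [hB]
    exact (hasFDerivAt_inv_norm hy).fderiv
  have h2 := ((hasFDerivAt_inv_norm_pow_three hx).smul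
    B.hasFDerivAt).congr_of_eventuallyEq h1
  rw [InnerProductSpace.laplacian_eq_iteratedFDeriv_orthonormalBasis _
    (EuclideanSpace.basisFun (Fin 3) ℝ)]
  simp only [iteratedFDeriv_two_apply, h2.fderiv]
  have h4 : ∑ i, (3 * (‖x‖ ^ 5)⁻¹ * x i * x i) = 3 * (‖x‖ ^ 3)⁻¹ := by
    have : ∀ i, 3 * (‖x‖ ^ 5)⁻¹ * x i * x i = 3 * (‖x‖ ^ 5)⁻¹ * x i ^ 2 := fun i ↦ by ring
    simp only [this]
    rw [← Finset.mul_sum, sum_sq_eq_norm_sq]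
    field_simp
  simp [hBv, EuclideanSpace.inner_single_right, Finset.sum_add_distrib, h4]

lemma harmonicAt_inv_norm {x : E3} (hx : x ≠ 0) :
    InnerProductSpace.HarmonicAt (fun y : E3 ↦ ‖y‖⁻¹) x :=
  ⟨(contDiffAt_norm ℝ hx).inv (norm_ne_zero_iff.2 hx), by
    filter_upwards [isOpen_ne.mem_nhds hx] with y hy
    exact laplacian_inv_norm hy⟩

lemma closure_eq_closedBall {r : ℝ} (hr : 0 < r) {F : Set E3}
    (hF : F = Metric.ball 0 r ∨ F = Metric.closedBall 0 r) :
    closure F = Metric.closedBall 0 r := by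
  rcases hF with rfl | rfl
  · exact closure_ball 0 hr.ne'
  · exact Metric.isClosed_closedBall.closure_eq

lemma isCapacitaryPotential_profile {r : ℝ} (hr : 0 < r) {F : Set E3}
    (hF : F = Metric.ball 0 r ∨ F = Metric.closedBall 0 r) :
    IsCapacitaryPotential F (fun x ↦ profile r 0 ‖x‖) (profileGradient r 0) where
  toHasL2WeakGradient := hasL2WeakGradient_profile hr one_pos
  eq_one x hx := by
    have h := subset_closure hx
    rw [closure_eq_closedBall hr hF, mem_closedBall_zero_iff] at h
    simp [profile, max_eq_left h, hr.ne']
  harmonic x hx := by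
    rw [closure_eq_closedBall hr hF, Set.mem_compl_iff, mem_closedBall_zero_iff, not_le] at hx
    have hx0 : x ≠ 0 := norm_pos_iff.1 (hr.trans hx)
    have h := (harmonicAt_inv_norm hx0).const_smul (c := r)
    refine (InnerProductSpace.harmonicAt_congr_nhds ?_).1 h
    filter_upwards [continuous_norm.continuousAt (Ioi_mem_nhds hx)] with y hy
    have hy' : r < ‖y‖ := hy
    have hy0 : 0 < ‖y‖ := hr.trans hy'
    simp only [Pi.smul_apply, smul_eq_mul, profile, max_eq_right hy'.le, sub_zero]
    rw [max_eq_left (by positivity), div_eq_mul_inv]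
  tendsto_zero := by
    have h : Tendsto (fun x : E3 ↦ r / ‖x‖) (cocompact E3) (𝓝 0) :=
      (tendsto_norm_cocompact_atTop).const_div_atTop r
    refine h.congr' ?_
    filter_upwards [tendsto_norm_cocompact_atTop.eventually (eventually_gt_atTop r)] with x hx
    have hx0 : 0 < ‖x‖ := hr.trans hx
    rw [profile, max_eq_right hx.le, sub_zero, max_eq_left (by positivity)]

/-! ### Volume of the ball and existence of the best constant -/

lemma measurableSet_of_eq_ball {r : ℝ} {F : Set E3}
    (hF : F = Metric.ball 0 r ∨ F = Metric.closedBall 0 r) : MeasurableSet F := by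
  rcases hF with rfl | rfl
  · exact measurableSet_ball
  · exact measurableSet_closedBall

lemma volume_real_of_eq_ball {r : ℝ} (hr : 0 < r) {F : Set E3}
    (hF : F = Metric.ball 0 r ∨ F = Metric.closedBall 0 r) :
    volume.real F = 4 / 3 * Real.pi * r ^ 3 := by
  have h : volume F = ENNReal.ofReal r ^ 3 * ENNReal.ofReal (Real.pi * 4 / 3) := by
    rcases hF with rfl | rfl
    · exact EuclideanSpace.volume_ball_fin_three 0 r
    · exact EuclideanSpace.volume_closedBall_fin_three 0 r
  rw [Measure.real, h, ENNReal.toReal_mul, ENNReal.toReal_pow, ENNReal.toReal_ofReal hr.le,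
    ENNReal.toReal_ofReal (by positivity)]
  ring

/-- `k` is a constant for which the inequality defining `k(F)` holds. -/
def Admissible (F : Set E3) (k : ℝ) : Prop :=
  ∀ (f : E3 → ℝ) (G : E3 → E3), MemDirichlet f G →
    k ^ 2 * ∫ x in F, f x ^ 2 ≤ 1 / (4 * Real.pi) * ∫ x, ‖G x‖ ^ 2

lemma Admissible.sq_mul_le {r : ℝ} (hr : 0 < r) {F : Set E3}
    (hF : F = Metric.ball 0 r ∨ F = Metric.closedBall 0 r) {k : ℝ} (hk : Admissible F k) :
    k ^ 2 * volume.real F ≤ r := by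
  have key : ∀ ε ∈ Set.Ioo (0 : ℝ) 1, k ^ 2 * ((1 - ε) ^ 2 * volume.real F) ≤ r := by
    rintro ε ⟨h0, h1⟩
    have h := hk _ _ (memDirichlet_profile hr h0 h1)
    have hint : ∫ x in F, profile r ε ‖x‖ ^ 2 = (1 - ε) ^ 2 * volume.real F := by
      have : ∀ x ∈ F, profile r ε ‖x‖ ^ 2 = (1 - ε) ^ 2 := by
        intro x hx
        have h := subset_closure hx
        rw [closure_eq_closedBall hr hF, mem_closedBall_zero_iff] at h
        rw [profile, max_eq_left h, div_self hr.ne', max_eq_left (by linarith)]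
      rw [setIntegral_congr_fun (measurableSet_of_eq_ball hF) this, setIntegral_const,
        smul_eq_mul, mul_comm]
    rw [hint] at h
    refine h.trans ?_
    rw [one_div_mul_eq_div, div_le_iff₀ (by positivity)]
    linarith [integral_norm_profileGradient_sq_le hr ε]
  have hlim : Tendsto (fun ε : ℝ ↦ k ^ 2 * ((1 - ε) ^ 2 * volume.real F)) (𝓝[>] 0)
      (𝓝 (k ^ 2 * volume.real F)) := by
    have hc : Continuous fun ε : ℝ ↦ k ^ 2 * ((1 - ε) ^ 2 * volume.real F) := by fun_prop
    simpa using (hc.tendsto 0).mono_left nhdsWithin_le_nhds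
  refine le_of_tendsto hlim ?_
  filter_upwards [Ioo_mem_nhdsGT one_pos] with ε hε using key ε hε

/-- The admissible constants are bounded by `√(r / |F|)`, and for fixed `f` the inequality is closed
in `k`, so the supremum is attained. -/
lemma exists_isBestConstant {r : ℝ} (hr : 0 < r) {F : Set E3}
    (hF : F = Metric.ball 0 r ∨ F = Metric.closedBall 0 r) {k₀ : ℝ} (hk₀ : 0 < k₀)
    (h : Admissible F k₀) : ∃ k, IsBestConstant F k := by
  have hV : 0 < volume.real F := by rw [volume_real_of_eq_ball hr hF]; positivity
  set S := {k : ℝ | 0 < k ∧ Admissible F k} with hS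
  have hbdd : BddAbove S := by
    refine ⟨√(r / volume.real F), fun k hk ↦ Real.le_sqrt_of_sq_le ?_⟩
    rw [le_div_iff₀ hV]
    exact hk.2.sq_mul_le hr hF
  have hne : S.Nonempty := ⟨k₀, hk₀, h⟩
  refine ⟨sSup S, ⟨hk₀.trans_le (le_csSup hbdd ⟨hk₀, h⟩), fun f G hfG ↦ ?_⟩,
    fun k hk ↦ le_csSup hbdd hk⟩
  obtain ⟨u, -, hu, huS⟩ := exists_seq_tendsto_sSup hne hbdd
  exact le_of_tendsto ((hu.pow 2).mul_const _) (.of_forall fun n ↦ (huS n).2 f G hfG)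

/-! ### Ramps and the smooth flux field -/

/-- A smooth monotone function, equal to `0` on `(-∞, a]` and to `1` on `[2a, ∞)`. -/
noncomputable def ramp (a ρ : ℝ) : ℝ := Real.smoothTransition (ρ / a - 1)

lemma ramp_nonneg (a ρ : ℝ) : 0 ≤ ramp a ρ := Real.smoothTransition.nonneg _

lemma ramp_le_one (a ρ : ℝ) : ramp a ρ ≤ 1 := Real.smoothTransition.le_one _

lemma ramp_of_le {a ρ : ℝ} (ha : 0 < a) (h : ρ ≤ a) : ramp a ρ = 0 :=
  Real.smoothTransition.zero_of_nonpos (by rw [sub_nonpos]; exact (div_le_one ha).2 h)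

lemma ramp_of_ge {a ρ : ℝ} (ha : 0 < a) (h : 2 * a ≤ ρ) : ramp a ρ = 1 :=
  Real.smoothTransition.one_of_one_le (by
    have : 2 ≤ ρ / a := (le_div_iff₀ ha).2 h
    linarith)

lemma contDiff_ramp (a : ℝ) : ContDiff ℝ ∞ (ramp a) :=
  Real.smoothTransition.contDiff.comp ((contDiff_id.div_const a).sub contDiff_const)

lemma hasDerivAt_ramp (a ρ : ℝ) : HasDerivAt (ramp a) (deriv (ramp a) ρ) ρ :=
  ((contDiff_ramp a).differentiable (by simp) ρ).hasDerivAt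

lemma deriv_ramp_nonneg {a : ℝ} (ha : 0 < a) (ρ : ℝ) : 0 ≤ deriv (ramp a) ρ := by
  refine Monotone.deriv_nonneg fun x y h ↦ Real.smoothTransition.monotone ?_
  gcongr

lemma deriv_ramp_of_lt {a ρ : ℝ} (ha : 0 < a) (h : ρ < a) : deriv (ramp a) ρ = 0 := by
  refine ((hasDerivAt_const ρ (0 : ℝ)).congr_of_eventuallyEq ?_).deriv
  filter_upwards [Iio_mem_nhds h] with y hy using ramp_of_le ha (le_of_lt hy)

lemma deriv_ramp_of_gt {a ρ : ℝ} (ha : 0 < a) (h : 2 * a < ρ) : deriv (ramp a) ρ = 0 := by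
  refine ((hasDerivAt_const ρ (1 : ℝ)).congr_of_eventuallyEq ?_).deriv
  filter_upwards [Ioi_mem_nhds h] with y hy using ramp_of_ge ha (le_of_lt hy)

/-- The divergence of the vector field `x ↦ ramp a ‖x‖ / ‖x‖ ^ 3 • x`. -/
noncomputable def rampDiv (a : ℝ) (x : E3) : ℝ := deriv (ramp a) ‖x‖ / ‖x‖ ^ 2

lemma rampDiv_nonneg {a : ℝ} (ha : 0 < a) (x : E3) : 0 ≤ rampDiv a x :=
  div_nonneg (deriv_ramp_nonneg ha _) (by positivity)

lemma tendsto_ramp {a : ℝ} (ha : 0 < a) : Tendsto (ramp a) atTop (𝓝 1) :=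
  tendsto_const_nhds.congr' <| by
    filter_upwards [eventually_ge_atTop (2 * a)] with y hy using (ramp_of_ge ha hy).symm

lemma integrable_rampDiv {a : ℝ} (ha : 0 < a) : Integrable (rampDiv a) := by
  refine integrable_radial (f := fun ρ ↦ deriv (ramp a) ρ / ρ ^ 2) ?_
  refine (integrableOn_Ioi_deriv_of_nonneg' (fun x _ ↦ hasDerivAt_ramp a x)
    (fun x _ ↦ deriv_ramp_nonneg ha x) (tendsto_ramp ha)).congr_fun (fun y hy ↦ ?_)
    measurableSet_Ioi
  have hy : 0 < y := hy
  field_simp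

/-- In polar coordinates the weight `y²` cancels, leaving `4π` times the total increase of the ramp.
-/
lemma integral_rampDiv {a : ℝ} (ha : 0 < a) : ∫ x, rampDiv a x = 4 * Real.pi := by
  have h := integral_radial fun ρ ↦ deriv (ramp a) ρ / ρ ^ 2
  have h2 : ∫ y in Set.Ioi (0 : ℝ), y ^ 2 * (deriv (ramp a) y / y ^ 2) = 1 := by
    rw [setIntegral_congr_fun (g := deriv (ramp a)) measurableSet_Ioi fun y hy ↦ ?_,
      integral_Ioi_of_hasDerivAt_of_nonneg' (fun x _ ↦ hasDerivAt_ramp a x)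
        (fun x _ ↦ deriv_ramp_nonneg ha x) (tendsto_ramp ha), ramp_of_le ha ha.le, sub_zero]
    have hy : 0 < y := hy
    field_simp
  rw [h2, mul_one] at h
  exact h

/-- The radial density of the flux field `x ↦ (ramp a ‖x‖ - ramp b ‖x‖) / ‖x‖ ^ 3 • x`. -/
noncomputable def fluxDensity (a b ρ : ℝ) : ℝ := (ramp a ρ - ramp b ρ) / ρ ^ 3

lemma contDiff_flux {a b : ℝ} (ha : 0 < a) (hb : 0 < b) (i : Fin 3) :
    ContDiff ℝ ∞ fun x : E3 ↦ fluxDensity a b ‖x‖ * x i := by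
  rw [contDiff_iff_contDiffAt]
  intro x
  rcases eq_or_ne x 0 with rfl | hx
  · refine (contDiffAt_const (c := (0 : ℝ))).congr_of_eventuallyEq ?_
    filter_upwards [Metric.ball_mem_nhds (0 : E3) (lt_min ha hb)] with y hy
    rw [mem_ball_zero_iff, lt_min_iff] at hy
    simp [fluxDensity, ramp_of_le ha hy.1.le, ramp_of_le hb hy.2.le]
  · have hn : ContDiffAt ℝ ∞ (fun y : E3 ↦ ‖y‖) x := contDiffAt_norm ℝ hx
    have hra : ContDiffAt ℝ ∞ (fun y : E3 ↦ ramp a ‖y‖) x :=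
      (contDiff_ramp a).contDiffAt.comp x hn
    have hrb : ContDiffAt ℝ ∞ (fun y : E3 ↦ ramp b ‖y‖) x :=
      (contDiff_ramp b).contDiffAt.comp x hn
    refine ((hra.sub hrb).div (hn.pow 3) ?_).mul ?_
    · exact pow_ne_zero 3 (norm_ne_zero_iff.2 hx)
    · exact (EuclideanSpace.proj (𝕜 := ℝ) i).contDiff.contDiffAt

/-- Far out both ramps equal `1` and cancel; near the origin both vanish and remove the singularity.
The difference is thus a legitimate test field. -/
lemma hasCompactSupport_flux {a b : ℝ} (ha : 0 < a) (hb : 0 < b) (i : Fin 3) :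
    HasCompactSupport fun x : E3 ↦ fluxDensity a b ‖x‖ * x i := by
  refine HasCompactSupport.intro (isCompact_closedBall (0 : E3) (max (2 * a) (2 * b)))
    fun x hx ↦ ?_
  rw [mem_closedBall_zero_iff, not_le, max_lt_iff] at hx
  simp [fluxDensity, ramp_of_ge ha hx.1.le, ramp_of_ge hb hx.2.le]

/-- Since `x / ‖x‖³` is divergence free off the origin, only the derivatives of the ramps survive.
-/
lemma sum_fderiv_flux (a b : ℝ) {x : E3} (hx : x ≠ 0) :
    ∑ i, fderiv ℝ (fun y : E3 ↦ fluxDensity a b ‖y‖ * y i) x (EuclideanSpace.single i 1)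
      = rampDiv a x - rampDiv b x := by
  have hx' : ‖x‖ ≠ 0 := norm_ne_zero_iff.2 hx
  set d := ((deriv (ramp a) ‖x‖ - deriv (ramp b) ‖x‖) * ‖x‖ ^ 3 -
      (ramp a ‖x‖ - ramp b ‖x‖) * (3 * ‖x‖ ^ 2)) / (‖x‖ ^ 3) ^ 2 with hd
  have h : HasDerivAt (fluxDensity a b) d ‖x‖ := by
    have h3 : HasDerivAt (fun ρ : ℝ ↦ ρ ^ 3) (3 * ‖x‖ ^ 2) ‖x‖ := by
      simpa using hasDerivAt_pow 3 ‖x‖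
    exact ((hasDerivAt_ramp a ‖x‖).sub (hasDerivAt_ramp b ‖x‖)).div h3 (pow_ne_zero 3 hx')
  have hi : ∀ i, fderiv ℝ (fun y : E3 ↦ fluxDensity a b ‖y‖ * y i) x
      (EuclideanSpace.single i 1) = d / ‖x‖ * x i ^ 2 + fluxDensity a b ‖x‖ := by
    intro i
    have h1 := (hasFDerivAt_radial hx h).mul (EuclideanSpace.proj (𝕜 := ℝ) i).hasFDerivAt (x := x)
    have h2 : fderiv ℝ (fun y : E3 ↦ fluxDensity a b ‖y‖ * y i) x = _ := h1.fderiv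
    rw [h2, add_apply, smul_apply, smul_apply, smul_apply, innerSL_single]
    simp
    ring
  simp only [hi]
  rw [Finset.sum_add_distrib, ← Finset.mul_sum, sum_sq_eq_norm_sq, hd]
  simp only [Finset.sum_const, Finset.card_univ, Fintype.card_fin, fluxDensity, rampDiv]
  rw [nsmul_eq_mul]
  field_simp
  push_cast
  ring

/-! ### Every potential of the ball has capacity at least `r` -/

lemma memLp_coord {G : E3 → E3} (hG : MemLp G 2 volume) (i : Fin 3) :
    MemLp (fun x ↦ G x i) 2 volume :=
  (EuclideanSpace.proj (𝕜 := ℝ) i).comp_memLp' hG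

lemma integral_fderiv_eq_zero {φ : E3 → ℝ} (hφ : ContDiff ℝ ∞ φ) (hc : HasCompactSupport φ)
    (v : E3) : ∫ x, fderiv ℝ φ x v = 0 := by
  have hd : Integrable fun x ↦ fderiv ℝ φ x v :=
    ((hφ.continuous_fderiv (by simp)).clm_apply continuous_const).integrable_of_hasCompactSupport
      (hc.fderiv_apply ℝ v)
  have h := integral_mul_fderiv_eq_neg_fderiv_mul_of_integrable (μ := (volume : Measure E3))
    (f := fun _ : E3 ↦ (1 : ℝ)) (g := φ) (v := v) (by simp) (by simpa using hd)
    (by simpa using hφ.continuous.integrable_of_hasCompactSupport hc)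
    (fun _ _ ↦ differentiableAt_const _) (fun x _ ↦ hφ.differentiable (by simp) x)
  simpa using h

lemma HasL2WeakGradient.ae_eq_zero_of_eq_const {U : E3 → ℝ} {G : E3 → E3}
    (h : HasL2WeakGradient U G) {s : Set E3} (hs : IsOpen s) {c : ℝ} (hU : ∀ x ∈ s, U x = c) :
    ∀ᵐ x, x ∈ s → G x = 0 := by
  have key : ∀ i, ∀ᵐ x, x ∈ s → G x i = 0 := fun i ↦ by
    refine IsOpen.ae_eq_zero_of_integral_contDiff_smul_eq_zero hs
      (((memLp_coord h.memLp_gradient i).locallyIntegrable (by norm_num)).locallyIntegrableOn s)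
      fun φ hφ hc hsupp ↦ ?_
    have h1 := h.integral_eq φ hφ hc i
    have h2 : ∀ x, U x * fderiv ℝ φ x (EuclideanSpace.single i 1)
        = c * fderiv ℝ φ x (EuclideanSpace.single i 1) := by
      intro x
      by_cases hx : x ∈ tsupport φ
      · rw [hU x (hsupp hx)]
      · simp [fderiv_of_notMem_tsupport ℝ hx]
    simp only [h2, integral_const_mul, integral_fderiv_eq_zero hφ hc, mul_zero] at h1
    simp only [smul_eq_mul, mul_comm (φ _)]
    linarith
  filter_upwards [ae_all_iff.2 key] with x hx hxs
  ext i
  exact hx i hxs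

/-- The ramp with `a = r / 3` rises between `r / 3` and `2r / 3`, strictly inside the ball, where `U
= 1`. -/
lemma integral_mul_rampDiv_of_eq_one {r : ℝ} (hr : 0 < r) {U : E3 → ℝ}
    (hU : ∀ x ∈ Metric.ball 0 r, U x = 1) : ∀ x, U x * rampDiv (r / 3) x = rampDiv (r / 3) x := by
  intro x
  by_cases hx : ‖x‖ < r
  · rw [hU x (mem_ball_zero_iff.2 hx), one_mul]
  · rw [rampDiv, deriv_ramp_of_gt (by positivity) (by linarith)]
    simp

lemma norm_flux_le {a b : ℝ} {x : E3} (hx : x ≠ 0) (v : E3) :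
    |∑ i, v i * (fluxDensity a b ‖x‖ * x i)| ≤ ‖v‖ * (‖x‖ ^ 2)⁻¹ := by
  have hx' : 0 < ‖x‖ := norm_pos_iff.2 hx
  have h1 : ∑ i, v i * (fluxDensity a b ‖x‖ * x i) = fluxDensity a b ‖x‖ * inner ℝ v x := by
    rw [PiLp.inner_apply, Finset.mul_sum]
    refine Finset.sum_congr rfl fun i _ ↦ ?_
    simp
    ring
  have h2 : |fluxDensity a b ‖x‖| ≤ (‖x‖ ^ 3)⁻¹ := by
    rw [fluxDensity, abs_div, abs_of_pos (pow_pos hx' 3), div_eq_mul_inv]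
    refine mul_le_of_le_one_left (by positivity) ?_
    rw [abs_le]
    constructor <;> linarith [ramp_nonneg a ‖x‖, ramp_nonneg b ‖x‖, ramp_le_one a ‖x‖,
      ramp_le_one b ‖x‖]
  rw [h1, abs_mul]
  calc _ ≤ (‖x‖ ^ 3)⁻¹ * (‖v‖ * ‖x‖) :=
        mul_le_mul h2 (abs_real_inner_le_norm v x) (abs_nonneg _) (by positivity)
    _ = ‖v‖ * (‖x‖ ^ 2)⁻¹ := by field_simp

/-- The inner ramp sees `U = 1` and contributes `4π`; the outer one, placed where `|U| ≤ ε`,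
contributes at most `4πε`. So the flux integral is at least `4π(1 - ε)`. It lives outside the ball,
because `∇U = 0` inside, and there it is at most `∫ ‖G‖ / ‖x‖²`. -/
lemma HasL2WeakGradient.le_integral_compl {r : ℝ} (hr : 0 < r) {F : Set E3}
    (hF : F = Metric.ball 0 r ∨ F = Metric.closedBall 0 r) {U : E3 → ℝ} {G : E3 → E3}
    (h : HasL2WeakGradient U G) (hU : ∀ x ∈ F, U x = 1) (h0 : Tendsto U (cocompact E3) (𝓝 0)) :
    4 * Real.pi * r ≤ ∫ x in Fᶜ, ‖G x‖ ^ 2 := by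
  have hball : Metric.ball 0 r ⊆ F := by
    rcases hF with rfl | rfl
    · exact subset_rfl
    · exact Metric.ball_subset_closedBall
  have hFcl : F ⊆ Metric.closedBall 0 r := by
    rw [← closure_eq_closedBall hr hF]; exact subset_closure
  have hU1 : ∀ x ∈ Metric.ball 0 r, U x = 1 := fun x hx ↦ hU x (hball hx)
  have hG0 := h.ae_eq_zero_of_eq_const Metric.isOpen_ball hU1
  have hG2 : Integrable fun x ↦ ‖G x‖ ^ 2 := h.memLp_gradient.integrable_norm_pow (by norm_num)
  have hFm := (measurableSet_of_eq_ball hF).compl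
  have key : ∀ ε > 0, 4 * Real.pi * r - 8 * Real.pi * r * ε ≤ ∫ x in Fᶜ, ‖G x‖ ^ 2 := by
    intro ε hε
    obtain ⟨b, hb, hUb⟩ : ∃ b > 0, ∀ x : E3, b ≤ ‖x‖ → |U x| ≤ ε := by
      have h1 : {x | |U x| < ε} ∈ cocompact E3 :=
        h0.abs.eventually (gt_mem_nhds (by simpa using hε))
      obtain ⟨t, ht, hts⟩ := mem_cocompact.1 h1
      obtain ⟨R, hR⟩ := ht.isBounded.subset_closedBall (0 : E3)
      refine ⟨max (R + 1) 1, by positivity, fun x hx ↦ ?_⟩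
      have hxt : x ∉ t := fun hxt ↦ by
        have h2 := mem_closedBall_zero_iff.1 (hR hxt)
        linarith [le_max_left (R + 1) 1]
      exact (show |U x| < ε from hts hxt).le
    set a := r / 3
    have ha : 0 < a := by positivity
    have hUD : ∀ x, |U x * rampDiv b x| ≤ ε * rampDiv b x := by
      intro x
      rw [abs_mul, abs_of_nonneg (rampDiv_nonneg hb x)]
      by_cases hx : ‖x‖ < b
      · simp [rampDiv, deriv_ramp_of_lt hb hx]
      · exact mul_le_mul_of_nonneg_right (hUb x (not_lt.1 hx)) (rampDiv_nonneg hb x)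
    have hUDi : Integrable fun x ↦ U x * rampDiv b x :=
      ((integrable_rampDiv hb).const_mul ε).mono'
        (h.locallyIntegrable.aestronglyMeasurable.mul
          (integrable_rampDiv hb).aestronglyMeasurable) (.of_forall hUD)
    have hUD' : ∫ x, U x * rampDiv b x ≤ ε * (4 * Real.pi) := by
      rw [← integral_rampDiv hb, ← integral_const_mul]
      exact integral_mono hUDi ((integrable_rampDiv hb).const_mul ε)
        fun x ↦ (le_abs_self _).trans (hUD x)
    have hφi : ∀ i, Integrable fun x ↦ U x *
        fderiv ℝ (fun y : E3 ↦ fluxDensity a b ‖y‖ * y i) x (EuclideanSpace.single i 1) := by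
      intro i
      simpa [mul_comm] using h.locallyIntegrable.integrable_smul_left_of_hasCompactSupport
        (((contDiff_flux ha hb i).continuous_fderiv (by simp)).clm_apply continuous_const)
        ((hasCompactSupport_flux ha hb i).fderiv_apply ℝ (EuclideanSpace.single i 1))
    have hGi : ∀ i, Integrable fun x ↦ G x i * (fluxDensity a b ‖x‖ * x i) := by
      intro i
      simpa [mul_comm] using ((memLp_coord h.memLp_gradient i).locallyIntegrable
        (by norm_num)).integrable_smul_left_of_hasCompactSupport
        (contDiff_flux ha hb i).continuous (hasCompactSupport_flux ha hb i)
    have hsum : 4 * Real.pi - ∫ x, U x * rampDiv b x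
        = -∫ x, ∑ i, G x i * (fluxDensity a b ‖x‖ * x i) := by
      rw [integral_finsetSum _ fun i _ ↦ hGi i, ← Finset.sum_neg_distrib]
      simp only [← fun i ↦ h.integral_eq _ (contDiff_flux ha hb i)
        (hasCompactSupport_flux ha hb i) i]
      rw [← integral_finsetSum _ fun i _ ↦ hφi i, ← integral_rampDiv ha,
        ← integral_sub (integrable_rampDiv ha) hUDi]
      refine integral_congr_ae ?_
      filter_upwards [ae_norm_ne 0] with x hx
      rw [← Finset.mul_sum, sum_fderiv_flux a b (norm_ne_zero_iff.1 hx), mul_sub,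
        integral_mul_rampDiv_of_eq_one hr hU1]
    have hbound : -∫ x, ∑ i, G x i * (fluxDensity a b ‖x‖ * x i) ≤
        (2 * r)⁻¹ * (∫ x in Fᶜ, ‖G x‖ ^ 2) + (2 * r)⁻¹ * (4 * Real.pi * r) := by
      rw [← integral_exteriorEnergy hr, ← integral_neg, ← integral_indicator hFm,
        ← integral_const_mul, ← integral_const_mul, ← integral_add
        ((hG2.indicator hFm).const_mul _) ((integrable_exteriorEnergy hr).const_mul _)]
      refine integral_mono_ae (integrable_finsetSum _ fun i _ ↦ hGi i).neg
        (((hG2.indicator hFm).const_mul _).add ((integrable_exteriorEnergy hr).const_mul _)) ?_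
      filter_upwards [hG0, ae_norm_ne r] with x hx hxr
      rcases lt_or_gt_of_ne hxr with hlt | hgt
      · have hG : G x = 0 := hx (mem_ball_zero_iff.2 hlt)
        have h1 : 0 ≤ Fᶜ.indicator (fun x ↦ ‖G x‖ ^ 2) x :=
          Set.indicator_nonneg (fun y _ ↦ by positivity) x
        have h2 := exteriorEnergy_nonneg r ‖x‖
        simp only [hG, PiLp.zero_apply, zero_mul, Finset.sum_const_zero, neg_zero]
        positivity
      · have hxF : x ∈ Fᶜ := fun hxF ↦ by
          have := mem_closedBall_zero_iff.1 (hFcl hxF)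
          linarith
        have hx0 : 0 < ‖x‖ := hr.trans hgt
        have h1 := norm_flux_le (a := a) (b := b) (norm_pos_iff.1 hx0) (G x)
        rw [Set.indicator_of_mem hxF, exteriorEnergy, if_pos hgt]
        refine (neg_le_abs _).trans (h1.trans ?_)
        -- Young's inequality with the weight that gives equality for `‖G x‖ = r / ‖x‖²`, the
        -- gradient norm of `r / ‖x‖`.
        have h2 : (2 * r)⁻¹ * ‖G x‖ ^ 2 + (2 * r)⁻¹ * (r ^ 2 / ‖x‖ ^ 4) - ‖G x‖ * (‖x‖ ^ 2)⁻¹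
            = (2 * r)⁻¹ * (‖G x‖ - r * (‖x‖ ^ 2)⁻¹) ^ 2 := by
          field_simp
          ring
        have h3 : 0 ≤ (2 * r)⁻¹ * (‖G x‖ - r * (‖x‖ ^ 2)⁻¹) ^ 2 := by positivity
        linarith
    rw [← hsum] at hbound
    -- Multiplied by `2r`, the bound reads `8πr(1 - ε) ≤ ∫ ‖G‖² + 4πr`; hence the error `8πrε`.
    have h4 : 2 * r * (4 * Real.pi - ε * (4 * Real.pi)) ≤
        2 * r * ((2 * r)⁻¹ * (∫ x in Fᶜ, ‖G x‖ ^ 2) + (2 * r)⁻¹ * (4 * Real.pi * r)) :=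
      mul_le_mul_of_nonneg_left (by linarith) (by positivity)
    rw [mul_add (2 * r) ((2 * r)⁻¹ * _), mul_inv_cancel_left₀ (by positivity),
      mul_inv_cancel_left₀ (by positivity)] at h4
    linarith
  have hlim : Tendsto (fun ε : ℝ ↦ 4 * Real.pi * r - 8 * Real.pi * r * ε) (𝓝[>] 0)
      (𝓝 (4 * Real.pi * r)) := by
    have hc : Continuous fun ε : ℝ ↦ 4 * Real.pi * r - 8 * Real.pi * r * ε := by fun_prop
    simpa using (hc.tendsto 0).mono_left nhdsWithin_le_nhds
  refine le_of_tendsto hlim ?_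
  filter_upwards [self_mem_nhdsWithin] with ε hε using key ε hε

/-! ### The Barta field and the inequality for differentiable functions -/

/-- The radial density of the vector field used in the Barta type estimate for the unit ball,
as a function of the square of the norm. -/
noncomputable def bartaDensity (s : ℝ) : ℝ := (1 + s ^ 2) / (s ^ 3 + s + 2)

/-- The derivative of `bartaDensity`. -/
noncomputable def bartaDensityDeriv (s : ℝ) : ℝ :=
  (-s ^ 4 - 2 * s ^ 2 + 4 * s - 1) / (s ^ 3 + s + 2) ^ 2

/-- The vector field `x ↦ bartaDensity (‖x‖² / r²) / r² • x`. -/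
noncomputable def bartaField (r : ℝ) (i : Fin 3) (x : E3) : ℝ :=
  bartaDensity (‖x‖ ^ 2 / r ^ 2) / r ^ 2 * x i

lemma hasDerivAt_bartaDensity {s : ℝ} (hs : 0 ≤ s) :
    HasDerivAt bartaDensity (bartaDensityDeriv s) s := by
  have hq : s ^ 3 + s + 2 ≠ 0 := by positivity
  have h2 : HasDerivAt (fun t : ℝ ↦ t ^ 2) (2 * s) s := by simpa using hasDerivAt_pow 2 s
  have h3 : HasDerivAt (fun t : ℝ ↦ t ^ 3) (3 * s ^ 2) s := by simpa using hasDerivAt_pow 3 s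
  have h := (h2.const_add 1).div ((h3.add (hasDerivAt_id s)).add_const 2) hq
  have e : bartaDensityDeriv s = (2 * s * (s ^ 3 + s + 2) - (1 + s ^ 2) * (3 * s ^ 2 + 1)) /
      (s ^ 3 + s + 2) ^ 2 := by
    rw [bartaDensityDeriv]
    ring
  rw [e]
  exact h

lemma hasFDerivAt_bartaField (r : ℝ) (i : Fin 3) (x : E3) :
    HasFDerivAt (bartaField r i)
      ((bartaDensity (‖x‖ ^ 2 / r ^ 2) / r ^ 2) • EuclideanSpace.proj i +
        x i • ((bartaDensityDeriv (‖x‖ ^ 2 / r ^ 2) * (2 / r ^ 4)) • innerSL ℝ x)) x := by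
  have h1 : HasFDerivAt (fun y : E3 ↦ ‖y‖ ^ 2 / r ^ 2) ((2 / r ^ 2) • innerSL ℝ x) x := by
    have h := (hasStrictFDerivAt_norm_sq x).hasFDerivAt.mul_const (r ^ 2)⁻¹
    simp only [← div_eq_mul_inv] at h
    refine h.congr_fderiv ?_
    ext v
    simp
    ring
  have h2 := ((hasDerivAt_bartaDensity (s := ‖x‖ ^ 2 / r ^ 2) (by positivity)).comp_hasFDerivAt x
    h1).mul_const (r ^ 2)⁻¹
  have h3 := h2.mul (EuclideanSpace.proj (𝕜 := ℝ) i).hasFDerivAt (x := x)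
  refine h3.congr_fderiv ?_
  ext v
  simp
  ring

lemma bartaField_partial (r : ℝ) (i : Fin 3) (x : E3) :
    fderiv ℝ (bartaField r i) x (EuclideanSpace.single i 1) =
      bartaDensity (‖x‖ ^ 2 / r ^ 2) / r ^ 2 +
        bartaDensityDeriv (‖x‖ ^ 2 / r ^ 2) * (2 / r ^ 4) * x i ^ 2 := by
  rw [(hasFDerivAt_bartaField r i x).fderiv, add_apply, smul_apply, smul_apply, smul_apply,
    innerSL_single]
  simp
  ring

lemma bartaDensity_nonneg {s : ℝ} (hs : 0 ≤ s) : 0 ≤ bartaDensity s := by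
  unfold bartaDensity; positivity

lemma bartaDensity_le_one {s : ℝ} (hs : 0 ≤ s) : bartaDensity s ≤ 1 := by
  rw [bartaDensity, div_le_one (by positivity)]
  nlinarith [mul_nonneg hs (sq_nonneg (s - 1)), sq_nonneg (s - 1)]

lemma mul_bartaDensity_le_one {s : ℝ} (hs : 0 ≤ s) : s * bartaDensity s ≤ 1 := by
  rw [bartaDensity, mul_div_assoc', div_le_one (by positivity)]
  nlinarith

lemma mul_abs_bartaDensityDeriv_le {s : ℝ} (hs : 0 ≤ s) : s * |bartaDensityDeriv s| ≤ 5 := by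
  rw [bartaDensityDeriv, abs_div, abs_of_nonneg (show 0 ≤ (s ^ 3 + s + 2) ^ 2 by positivity),
    mul_div_assoc', div_le_iff₀ (by positivity)]
  have h1 : |(-s ^ 4 - 2 * s ^ 2 + 4 * s - 1)| ≤ s ^ 4 + 2 * s ^ 2 + 4 * s + 1 := by
    rw [abs_le]
    constructor <;> nlinarith [pow_nonneg hs 4, pow_nonneg hs 2]
  refine (mul_le_mul_of_nonneg_left h1 hs).trans ?_
  have h2 : 0 ≤ s ^ 4 * (5 * s ^ 2 - s + 10) :=
    mul_nonneg (pow_nonneg hs 4) (by nlinarith [sq_nonneg (s - 1)])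
  nlinarith [pow_nonneg hs 3, pow_nonneg hs 2]

/-- With `s = ‖x‖² / r²`, the left side is `r² (div V - ‖V‖²)`. The numerator on the right is
positive, so the field can be used on all of `ℝ³`. -/
lemma bartaDensity_riccati {s : ℝ} (hs : 0 ≤ s) :
    3 * bartaDensity s + 2 * s * bartaDensityDeriv s - s * bartaDensity s ^ 2 =
      (14 * s ^ 2 + 6) / (s ^ 3 + s + 2) ^ 2 := by
  have hq : s ^ 3 + s + 2 ≠ 0 := by positivity
  rw [bartaDensity, bartaDensityDeriv]
  field_simp
  ring

/-- There is room to spare: the value at `s = 1` is `5 / 4`. This is why the crude `s³ ≤ s²`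
suffices. -/
lemma le_riccati_of_le_one {s : ℝ} (hs : 0 ≤ s) (hs1 : s ≤ 1) :
    9 / 8 ≤ (14 * s ^ 2 + 6) / (s ^ 3 + s + 2) ^ 2 := by
  rw [div_le_div_iff₀ (by norm_num) (by positivity)]
  have h3 : s ^ 3 ≤ s ^ 2 := pow_le_pow_of_le_one hs hs1 (by norm_num)
  have hq : s ^ 3 + s + 2 ≤ s ^ 2 + s + 2 := by linarith
  have hq2 : (s ^ 3 + s + 2) ^ 2 ≤ (s ^ 2 + s + 2) ^ 2 := pow_le_pow_left₀ (by positivity) hq 2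
  have h4 : 0 ≤ (1 - s) * s := mul_nonneg (by linarith) hs
  nlinarith [mul_nonneg h4 hs, mul_nonneg h4 (sq_nonneg s), sq_nonneg (s - 1 / 2),
    mul_nonneg (sub_nonneg.2 hs1) (sq_nonneg (s - 1 / 2))]

lemma sum_bartaField_sq (r : ℝ) (x : E3) :
    ∑ i, bartaField r i x ^ 2 =
      (bartaDensity (‖x‖ ^ 2 / r ^ 2) / r ^ 2) ^ 2 * ‖x‖ ^ 2 := by
  simp only [bartaField, mul_pow]
  rw [← Finset.mul_sum, sum_sq_eq_norm_sq]

lemma sum_partial_sub_sq {r : ℝ} (hr : 0 < r) (x : E3) :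
    ∑ i, (fderiv ℝ (bartaField r i) x (EuclideanSpace.single i 1) - bartaField r i x ^ 2) =
      (14 * (‖x‖ ^ 2 / r ^ 2) ^ 2 + 6) / ((‖x‖ ^ 2 / r ^ 2) ^ 3 + ‖x‖ ^ 2 / r ^ 2 + 2) ^ 2
        / r ^ 2 := by
  rw [Finset.sum_sub_distrib, sum_bartaField_sq]
  simp only [bartaField_partial]
  rw [Finset.sum_add_distrib, ← Finset.mul_sum, sum_sq_eq_norm_sq,
    ← bartaDensity_riccati (by positivity)]
  simp only [Finset.sum_const, Finset.card_univ, Fintype.card_fin, nsmul_eq_mul]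
  field_simp
  push_cast
  ring

/-- This bound and the next on the partial derivatives serve only to make the integration by parts
on `ℝ³` legitimate; their constants do not enter the result. -/
lemma abs_bartaField_le {r : ℝ} (hr : 0 < r) (i : Fin 3) (x : E3) :
    |bartaField r i x| ≤ 1 / r := by
  set s := ‖x‖ ^ 2 / r ^ 2 with hs
  have hs0 : 0 ≤ s := by positivity
  refine abs_le_of_sq_le_sq ?_ (by positivity)
  have hxs : ‖x‖ ^ 2 = s * r ^ 2 := by rw [hs]; field_simp
  calc bartaField r i x ^ 2 ≤ (bartaDensity s / r ^ 2) ^ 2 * ‖x‖ ^ 2 := by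
        rw [← sum_bartaField_sq]
        exact Finset.single_le_sum (f := fun j ↦ bartaField r j x ^ 2)
          (fun j _ ↦ sq_nonneg _) (Finset.mem_univ i)
    _ = (s * bartaDensity s) * bartaDensity s / r ^ 2 := by
        rw [hxs]
        field_simp
    _ ≤ 1 * 1 / r ^ 2 := by
        gcongr
        · exact bartaDensity_nonneg hs0
        · exact mul_bartaDensity_le_one hs0
        · exact bartaDensity_le_one hs0
    _ = (1 / r) ^ 2 := by rw [div_pow]; norm_num

lemma abs_bartaField_partial_le {r : ℝ} (hr : 0 < r) (i : Fin 3) (x : E3) :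
    |fderiv ℝ (bartaField r i) x (EuclideanSpace.single i 1)| ≤ 11 / r ^ 2 := by
  rw [bartaField_partial]
  set s := ‖x‖ ^ 2 / r ^ 2 with hs
  have hs0 : 0 ≤ s := by positivity
  have hxs : ‖x‖ ^ 2 = s * r ^ 2 := by rw [hs]; field_simp
  have hx : x i ^ 2 ≤ s * r ^ 2 := by
    rw [← hxs]
    exact sq_le_sq.2 (by simpa using abs_coord_le_norm x i)
  refine (abs_add_le _ _).trans ?_
  have h1 : |bartaDensity s / r ^ 2| ≤ 1 / r ^ 2 := by
    rw [abs_of_nonneg (div_nonneg (bartaDensity_nonneg hs0) (by positivity))]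
    gcongr
    exact bartaDensity_le_one hs0
  have h2 : |bartaDensityDeriv s * (2 / r ^ 4) * x i ^ 2| ≤ 10 / r ^ 2 := by
    rw [abs_mul, abs_mul, abs_of_nonneg (sq_nonneg (x i)),
      abs_of_nonneg (show 0 ≤ 2 / r ^ 4 by positivity)]
    calc |bartaDensityDeriv s| * (2 / r ^ 4) * x i ^ 2
        ≤ |bartaDensityDeriv s| * (2 / r ^ 4) * (s * r ^ 2) := by gcongr
      _ = 2 * (s * |bartaDensityDeriv s|) / r ^ 2 := by field_simp
      _ ≤ 2 * 5 / r ^ 2 := by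
        gcongr
        exact mul_abs_bartaDensityDeriv_le hs0
      _ = 10 / r ^ 2 := by norm_num
  calc _ ≤ 1 / r ^ 2 + 10 / r ^ 2 := add_le_add h1 h2
    _ = 11 / r ^ 2 := by ring

/-- Coordinatewise, `(∂ᵢf + f Vᵢ)² ≥ 0` and integration by parts give `∫ f² (∂ᵢVᵢ - Vᵢ²) ≤ ∫
(∂ᵢf)²`. After summation the weight is at least `9 / (8 r²)` on `F` and nonnegative elsewhere, so
the integral may be cut down to `F`. -/
lemma setIntegral_sq_le_of_differentiable {r : ℝ} (hr : 0 < r) {F : Set E3}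
    (hFm : MeasurableSet F) (hF : F ⊆ Metric.closedBall 0 r) {f : E3 → ℝ} (hf : Differentiable ℝ f)
    (hf2 : MemLp f 2 volume)
    (hg : ∀ i, MemLp (fun x ↦ fderiv ℝ f x (EuclideanSpace.single i 1)) 2 volume) :
    9 / 8 / r ^ 2 * ∫ x in F, f x ^ 2 ≤
      ∑ i, ∫ x, fderiv ℝ f x (EuclideanSpace.single i 1) ^ 2 := by
  have hV : ∀ i, Differentiable ℝ (bartaField r i) := fun i x ↦
    (hasFDerivAt_bartaField r i x).differentiableAt
  have hVm : ∀ i, AEStronglyMeasurable (bartaField r i) (volume : Measure E3) := fun i ↦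
    (hV i).continuous.aestronglyMeasurable
  have hpm : ∀ i, AEStronglyMeasurable
      (fun x ↦ fderiv ℝ (bartaField r i) x (EuclideanSpace.single i 1))
      (volume : Measure E3) := fun i ↦ (measurable_fderiv_apply_const ℝ _ _).aestronglyMeasurable
  have hf2i : Integrable fun x ↦ f x ^ 2 := hf2.integrable_sq
  have hgi : ∀ i, Integrable fun x ↦ fderiv ℝ f x (EuclideanSpace.single i 1) ^ 2 :=
    fun i ↦ (hg i).integrable_sq
  have hfp : ∀ i, Integrable fun x ↦
      f x ^ 2 * fderiv ℝ (bartaField r i) x (EuclideanSpace.single i 1) := fun i ↦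
    hf2i.mul_bdd (hpm i) (.of_forall fun x ↦ abs_bartaField_partial_le hr i x)
  have hfV : ∀ i, Integrable fun x ↦ f x ^ 2 * bartaField r i x := fun i ↦
    hf2i.mul_bdd (hVm i) (.of_forall fun x ↦ abs_bartaField_le hr i x)
  have hfVV : ∀ i, Integrable fun x ↦ f x ^ 2 * bartaField r i x ^ 2 := fun i ↦ by
    have h := (hfV i).mul_bdd (hVm i) (.of_forall fun x ↦ abs_bartaField_le hr i x)
    refine h.congr (.of_forall fun x ↦ ?_)
    ring
  have hd : ∀ i x, fderiv ℝ (fun y ↦ f y ^ 2) x (EuclideanSpace.single i 1) =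
      2 * (f x * fderiv ℝ f x (EuclideanSpace.single i 1)) := fun i x ↦ by
    rw [((hf x).hasFDerivAt.pow 2).fderiv]
    simp
    ring
  have hcross : ∀ i, Integrable fun x ↦
      2 * (f x * fderiv ℝ f x (EuclideanSpace.single i 1)) * bartaField r i x := fun i ↦
    ((hf2.integrable_mul (hg i)).const_mul 2).mul_bdd (hVm i)
      (.of_forall fun x ↦ abs_bartaField_le hr i x)
  have hparts : ∀ i, ∫ x, f x ^ 2 * fderiv ℝ (bartaField r i) x (EuclideanSpace.single i 1) =
      -∫ x, 2 * (f x * fderiv ℝ f x (EuclideanSpace.single i 1)) * bartaField r i x := fun i ↦ by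
    have h := integral_mul_fderiv_eq_neg_fderiv_mul_of_integrable (μ := (volume : Measure E3))
      (f := fun x ↦ f x ^ 2) (g := bartaField r i) (v := EuclideanSpace.single i 1)
      (by simpa only [hd] using hcross i) (hfp i) (hfV i) (fun x _ ↦ (hf x).pow 2)
      (fun x _ ↦ hV i x)
    simpa only [hd] using h
  have hterm : ∀ i, ∫ x, f x ^ 2 * (fderiv ℝ (bartaField r i) x (EuclideanSpace.single i 1)
      - bartaField r i x ^ 2) ≤ ∫ x, fderiv ℝ f x (EuclideanSpace.single i 1) ^ 2 := fun i ↦ by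
    have h : ∫ x, -(2 * (f x * fderiv ℝ f x (EuclideanSpace.single i 1)) * bartaField r i x) -
        f x ^ 2 * bartaField r i x ^ 2 ≤ ∫ x, fderiv ℝ f x (EuclideanSpace.single i 1) ^ 2 := by
      refine integral_mono ((hcross i).neg.sub (hfVV i)) (hgi i) fun x ↦ ?_
      simp only
      nlinarith [sq_nonneg (fderiv ℝ f x (EuclideanSpace.single i 1) + f x * bartaField r i x)]
    simp only [mul_sub]
    rw [integral_sub (hfp i) (hfVV i), hparts i, ← integral_neg]
    rwa [integral_sub (hcross i).fun_neg (hfVV i)] at h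
  have hdiff : ∀ i, Integrable fun x ↦ f x ^ 2 *
      (fderiv ℝ (bartaField r i) x (EuclideanSpace.single i 1) - bartaField r i x ^ 2) := fun i ↦ by
    simp only [mul_sub]
    exact (hfp i).sub (hfVV i)
  refine le_trans ?_ (Finset.sum_le_sum fun i _ ↦ hterm i)
  rw [← integral_finsetSum _ fun i _ ↦ hdiff i, ← integral_indicator hFm, ← integral_const_mul]
  refine integral_mono ((hf2i.indicator hFm).const_mul _)
    (integrable_finsetSum _ fun i _ ↦ hdiff i) fun x ↦ ?_
  simp only
  rw [← Finset.mul_sum, sum_partial_sub_sq hr]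
  by_cases hx : x ∈ F
  · rw [Set.indicator_of_mem hx, mul_comm]
    have hxr := mem_closedBall_zero_iff.1 (hF hx)
    have hs1 : ‖x‖ ^ 2 / r ^ 2 ≤ 1 := by
      rw [div_le_one (by positivity)]
      gcongr
    refine mul_le_mul_of_nonneg_left ?_ (sq_nonneg _)
    exact div_le_div_of_nonneg_right (le_riccati_of_le_one (by positivity) hs1) (by positivity)
  · rw [Set.indicator_of_notMem hx, mul_zero]
    positivity

/-! ### Mollification and passage to the Dirichlet class -/

/-- The convolution of `f` with the kernel `ρ`. -/
noncomputable def mollify (ρ f : E3 → ℝ) (x : E3) : ℝ := ∫ t, f t * ρ (x - t)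

lemma mollify_eq_convolution (ρ f : E3 → ℝ) :
    mollify ρ f = convolution f ρ (ContinuousLinearMap.mul ℝ ℝ) volume := rfl

/-- A smooth, compactly supported probability density. -/
structure IsMollifier (ρ : E3 → ℝ) : Prop where
  contDiff : ContDiff ℝ ∞ ρ
  hasCompactSupport : HasCompactSupport ρ
  nonneg : ∀ x, 0 ≤ ρ x
  integral_eq_one : ∫ x, ρ x = 1

lemma _root_.ContDiffBump.isMollifier (φ : ContDiffBump (0 : E3)) :
    IsMollifier (φ.normed volume) :=
  ⟨φ.contDiff_normed, φ.hasCompactSupport_normed, φ.nonneg_normed, φ.integral_normed⟩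

namespace IsMollifier

variable {ρ : E3 → ℝ}

lemma integrable (h : IsMollifier ρ) : Integrable ρ :=
  h.contDiff.continuous.integrable_of_hasCompactSupport h.hasCompactSupport

lemma contDiff_reflect (h : IsMollifier ρ) (x : E3) : ContDiff ℝ ∞ fun t ↦ ρ (x - t) :=
  h.contDiff.comp (contDiff_const.sub contDiff_id)

lemma hasCompactSupport_reflect (h : IsMollifier ρ) (x : E3) :
    HasCompactSupport fun t ↦ ρ (x - t) :=
  h.hasCompactSupport.comp_homeomorph (Homeomorph.subLeft x)

lemma integrable_mul_reflect (h : IsMollifier ρ) {g : E3 → ℝ} (hg : LocallyIntegrable g volume)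
    (x : E3) : Integrable fun t ↦ g t * ρ (x - t) := by
  simpa [mul_comm] using hg.integrable_smul_left_of_hasCompactSupport
    (h.contDiff_reflect x).continuous (h.hasCompactSupport_reflect x)

/-- Jensen's inequality, in the form that the variance of `g` under the density `t ↦ ρ (x - t)` is
nonnegative. -/
lemma mollify_sq_le (h : IsMollifier ρ) {g : E3 → ℝ} (hg : MemLp g 2 volume) (x : E3) :
    mollify ρ g x ^ 2 ≤ mollify ρ (fun t ↦ g t ^ 2) x := by
  set m := mollify ρ g x with hm
  have h1 := h.integrable_mul_reflect (hg.locallyIntegrable (by norm_num)) x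
  have h2 := h.integrable_mul_reflect hg.integrable_sq.locallyIntegrable x
  have h3 : Integrable fun t ↦ ρ (x - t) := h.integrable.comp_sub_left x
  have h4 : ∫ t, ρ (x - t) = 1 := by
    rw [integral_sub_left_eq_self ρ volume x, h.integral_eq_one]
  have h5 : 0 ≤ ∫ t, (g t - m) ^ 2 * ρ (x - t) :=
    integral_nonneg fun t ↦ mul_nonneg (sq_nonneg _) (h.nonneg _)
  have h6 : ∫ t, (g t - m) ^ 2 * ρ (x - t) =
      mollify ρ (fun t ↦ g t ^ 2) x - 2 * m * m + m ^ 2 * 1 := by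
    have e : ∀ t, (g t - m) ^ 2 * ρ (x - t) =
        (g t ^ 2 * ρ (x - t) - 2 * m * (g t * ρ (x - t))) + m ^ 2 * ρ (x - t) := fun t ↦ by ring
    have h21 : Integrable fun t ↦ g t ^ 2 * ρ (x - t) - 2 * m * (g t * ρ (x - t)) :=
      h2.sub (h1.const_mul _)
    simp only [e]
    rw [integral_add h21 (h3.const_mul _), integral_sub h2 (h1.const_mul _),
      integral_const_mul, integral_const_mul, h4]
    rfl
  rw [h6] at h5
  linarith

lemma contDiff_mollify (h : IsMollifier ρ) {g : E3 → ℝ} (hg : LocallyIntegrable g volume) :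
    ContDiff ℝ ∞ (mollify ρ g) :=
  h.hasCompactSupport.contDiff_convolution_right (ContinuousLinearMap.mul ℝ ℝ) hg h.contDiff

lemma memLp_mollify (h : IsMollifier ρ) {g : E3 → ℝ} (hg : MemLp g 2 volume) :
    MemLp (mollify ρ g) 2 volume := by
  have hm := (h.contDiff_mollify (hg.locallyIntegrable (by norm_num))).continuous
  rw [memLp_two_iff_integrable_sq hm.aestronglyMeasurable]
  refine (hg.integrable_sq.integrable_convolution (ContinuousLinearMap.mul ℝ ℝ)
    h.integrable).mono' (hm.pow 2).aestronglyMeasurable (.of_forall fun x ↦ ?_)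
  rw [Real.norm_eq_abs, abs_of_nonneg (sq_nonneg _)]
  exact h.mollify_sq_le hg x

lemma integral_mollify_sq_le (h : IsMollifier ρ) {g : E3 → ℝ} (hg : MemLp g 2 volume) :
    ∫ x, mollify ρ g x ^ 2 ≤ ∫ x, g x ^ 2 := by
  have h1 := integral_convolution (ContinuousLinearMap.mul ℝ ℝ) (μ := (volume : Measure E3))
    (ν := (volume : Measure E3)) hg.integrable_sq h.integrable
  rw [ContinuousLinearMap.mul_apply', h.integral_eq_one, mul_one] at h1
  rw [← h1]
  exact integral_mono (h.memLp_mollify hg).integrable_sq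
    (hg.integrable_sq.integrable_convolution _ h.integrable) fun x ↦ h.mollify_sq_le hg x

/-- The weak gradient identity is applied to the test function `t ↦ ρ (x - t)`; the sign from the
reflection cancels that of integration by parts. -/
lemma fderiv_mollify (h : IsMollifier ρ) {f : E3 → ℝ} {G : E3 → E3} (hf : HasL2WeakGradient f G)
    (x : E3) (i : Fin 3) :
    fderiv ℝ (mollify ρ f) x (EuclideanSpace.single i 1) = mollify ρ (fun t ↦ G t i) x := by
  have hρ1 : ContDiff ℝ 1 ρ := h.contDiff.of_le (by simp)
  have h1 := h.hasCompactSupport.hasFDerivAt_convolution_right (ContinuousLinearMap.mul ℝ ℝ)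
    hf.locallyIntegrable hρ1 x
  rw [mollify_eq_convolution, h1.fderiv, convolution_precompR_apply _ hf.locallyIntegrable
    (h.hasCompactSupport.fderiv ℝ) (hρ1.continuous_fderiv one_ne_zero), convolution_mul]
  have h2 := hf.integral_eq _ (h.contDiff_reflect x) (h.hasCompactSupport_reflect x) i
  have h3 : ∀ t, fderiv ℝ (fun t ↦ ρ (x - t)) t (EuclideanSpace.single i 1) =
      -fderiv ℝ ρ (x - t) (EuclideanSpace.single i 1) := fun t ↦ by
    have h4 := ((hρ1.differentiable one_ne_zero) (x - t)).hasFDerivAt.comp t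
      ((hasFDerivAt_id t).const_sub x)
    have h5 : fderiv ℝ (fun t ↦ ρ (x - t)) t = _ := h4.fderiv
    rw [h5]
    simp
  simp only [h3, mul_neg, integral_neg, neg_inj] at h2
  exact h2

end IsMollifier

lemma exists_isMollifier_tendsto {f : E3 → ℝ} (hf : LocallyIntegrable f volume) :
    ∃ ρ : ℕ → E3 → ℝ, (∀ n, IsMollifier (ρ n)) ∧
      ∀ᵐ x, Tendsto (fun n ↦ mollify (ρ n) f x) atTop (𝓝 (f x)) := by
  -- The ratio of outer to inner radius stays equal to `2`, as almost everywhere convergence for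
  -- locally integrable `f` requires it to be bounded.
  let φ : ℕ → ContDiffBump (0 : E3) := fun n ↦
    ⟨1 / ((n : ℝ) + 1), 2 * (1 / ((n : ℝ) + 1)), by positivity,
      lt_two_mul_self (by positivity)⟩
  refine ⟨fun n ↦ (φ n).normed volume, fun n ↦ (φ n).isMollifier, ?_⟩
  have hφ : Tendsto (fun n ↦ (φ n).rOut) atTop (𝓝 0) := by
    simpa only [mul_zero] using
      (tendsto_one_div_add_atTop_nhds_zero_nat (𝕜 := ℝ)).const_mul (2 : ℝ)
  filter_upwards [ContDiffBump.ae_convolution_tendsto_right_of_locallyIntegrable (K := 2) hφ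
    (.of_forall fun n ↦ le_rfl) hf] with x hx
  refine hx.congr fun n ↦ ?_
  rw [convolution_eq_swap, mollify]
  simp [mul_comm]

lemma integral_sq_le_of_ae_tendsto {α : Type*} [MeasurableSpace α] {μ : Measure α}
    {u : ℕ → α → ℝ} {f : α → ℝ} {c : ℝ} (hu : ∀ n, MemLp (u n) 2 μ) (hf : MemLp f 2 μ)
    (hlim : ∀ᵐ x ∂μ, Tendsto (fun n ↦ u n x) atTop (𝓝 (f x)))
    (hc : ∀ n, ∫ x, u n x ^ 2 ∂μ ≤ c) : ∫ x, f x ^ 2 ∂μ ≤ c := by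
  have hc0 : 0 ≤ c := (integral_nonneg fun x ↦ sq_nonneg (u 0 x)).trans (hc 0)
  rw [← ENNReal.ofReal_le_ofReal_iff hc0, ofReal_integral_eq_lintegral_ofReal hf.integrable_sq
    (.of_forall fun x ↦ sq_nonneg _)]
  have h1 : ∫⁻ x, ENNReal.ofReal (f x ^ 2) ∂μ =
      ∫⁻ x, liminf (fun n ↦ ENNReal.ofReal (u n x ^ 2)) atTop ∂μ := by
    refine lintegral_congr_ae (hlim.mono fun x hx ↦ ?_)
    exact ((ENNReal.continuous_ofReal.tendsto _).comp (hx.pow 2)).liminf_eq.symm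
  rw [h1]
  refine (lintegral_liminf_le' fun n ↦
    (hu n).integrable_sq.aestronglyMeasurable.aemeasurable.ennreal_ofReal).trans ?_
  refine liminf_le_of_le (h := fun b hb ↦ ?_)
  obtain ⟨n, hn⟩ := hb.exists
  refine hn.trans ?_
  rw [← ofReal_integral_eq_lintegral_ofReal (hu n).integrable_sq
    (.of_forall fun x ↦ sq_nonneg _)]
  exact ENNReal.ofReal_le_ofReal (hc n)

/-- Mollifying does not increase the `L²` norms of the partial derivatives, so the smooth case
bounds all mollified functions uniformly on `F`. Fatou's lemma (`integral_sq_le_of_ae_tendsto`)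
passes to the limit. -/
lemma MemDirichlet.setIntegral_sq_le {r : ℝ} (hr : 0 < r) {F : Set E3}
    (hFm : MeasurableSet F) (hF : F ⊆ Metric.closedBall 0 r) {f : E3 → ℝ} {G : E3 → E3}
    (h : MemDirichlet f G) : 9 / 8 / r ^ 2 * ∫ x in F, f x ^ 2 ≤ ∫ x, ‖G x‖ ^ 2 := by
  obtain ⟨ρ, hρ, hlim⟩ := exists_isMollifier_tendsto h.locallyIntegrable
  have hG : ∀ i, MemLp (fun x ↦ G x i) 2 volume := memLp_coord h.memLp_gradient
  have hsum : ∫ x, ‖G x‖ ^ 2 = ∑ i, ∫ x, G x i ^ 2 := by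
    rw [← integral_finsetSum _ fun i _ ↦ (hG i).integrable_sq]
    simp only [sum_sq_eq_norm_sq]
  have hpos : 0 < 9 / 8 / r ^ 2 := by positivity
  rw [← le_div_iff₀' hpos]
  refine integral_sq_le_of_ae_tendsto
    (fun n ↦ ((hρ n).memLp_mollify h.memLp).restrict F) (h.memLp.restrict F)
    (ae_restrict_of_ae hlim) fun n ↦ ?_
  rw [le_div_iff₀' hpos]
  have hd := (hρ n).fderiv_mollify h.toHasL2WeakGradient
  refine (setIntegral_sq_le_of_differentiable hr hFm hF
    (((hρ n).contDiff_mollify h.locallyIntegrable).differentiable (by simp))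
    ((hρ n).memLp_mollify h.memLp) fun i ↦ ?_).trans ?_
  · simp only [hd]
    exact (hρ n).memLp_mollify (hG i)
  · simp only [hd, hsum]
    exact Finset.sum_le_sum fun i _ ↦ (hρ n).integral_mollify_sq_le (hG i)

lemma admissible_of_eq_ball {r : ℝ} (hr : 0 < r) {F : Set E3}
    (hF : F = Metric.ball 0 r ∨ F = Metric.closedBall 0 r) :
    Admissible F (3 / (4 * r * √(2 * Real.pi))) := by
  intro f G hfG
  have h := hfG.setIntegral_sq_le hr (measurableSet_of_eq_ball hF)
    ((subset_closure).trans (closure_eq_closedBall hr hF).subset)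
  have hk : (3 / (4 * r * √(2 * Real.pi))) ^ 2 = 1 / (4 * Real.pi) * (9 / 8 / r ^ 2) := by
    rw [div_pow, mul_pow, Real.sq_sqrt (by positivity)]
    field_simp
    norm_num
  rw [hk, mul_assoc]
  exact mul_le_mul_of_nonneg_left h (by positivity)

end Conductor

theorem theorem2 (r : ℝ) (hr : 0 < r) (F : Set Conductor.E3)
    (hF : F = Metric.ball 0 r ∨ F = Metric.closedBall 0 r) :
    (∃ k : ℝ, Conductor.IsBestConstant F k) ∧
    (∃ c : ℝ, Conductor.IsCapacity F c) ∧
    ∀ k c : ℝ, Conductor.IsBestConstant F k → Conductor.IsCapacity F c →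
      3 / (4 * r * √(2 * Real.pi)) ≤ k ∧ k ≤ √(c / volume.real F) := by
  have hk₀ : 0 < 3 / (4 * r * √(2 * Real.pi)) := by positivity
  have hadm := Conductor.admissible_of_eq_ball hr hF
  refine ⟨Conductor.exists_isBestConstant hr hF hk₀ hadm,
    ⟨_, _, _, Conductor.isCapacitaryPotential_profile hr hF, rfl⟩, ?_⟩
  rintro k c hk ⟨U, G, hU, rfl⟩
  refine ⟨hk.2 ⟨hk₀, hadm⟩, Real.le_sqrt_of_sq_le ?_⟩
  have hV : 0 < volume.real F := by
    rw [Conductor.volume_real_of_eq_ball hr hF]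
    positivity
  rw [le_div_iff₀ hV]
  have h1 : k ^ 2 * volume.real F ≤ r :=
    Conductor.Admissible.sq_mul_le hr hF fun f H hf ↦ hk.1.2 f H hf
  have h2 := hU.toHasL2WeakGradient.le_integral_compl hr hF hU.eq_one hU.tendsto_zero
  refine h1.trans ?_
  rw [one_div_mul_eq_div, le_div_iff₀ (by positivity)]
  linarith
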